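/- Throughout, a digraph is finite, has no loops and no multiple edges, and may have anti-parallel edges; $\mathbb N$ contains $0$. Fix $d\in\mathbb N$. The $FB(d)$-model consists of all digraphs in which every vertex has at most $d$ outgoing and at most $d$ incoming neighbours. An algorithm accesses an $n$-vertex digraph $G$ of the model with vertex set $[n]$ by adaptive queries: a query names a vertex $v$, and the answer is the pair $(\Gamma^+(v),\Gamma^-(v))$ of its sets of outgoing and incoming neighbours. The distance of two digraphs on $[n]$ is the number of edges to be deleted or inserted to turn one into the other; they are $\epsilon$-close if it is at most $\epsilon dn$. A digraph $G$ is $\epsilon$-close to a set $A$ of digraphs on $[n]$ if it is $\epsilon$-close to some member of $A$, and $\epsilon$-far from $A$ otherwise; two sets $A,B$ of digraphs on $[n]$ are $\epsilon$-close if every member of each of them is $\epsilon$-close to the other. A property $P=\bigcup_n P_n$ is a set of digraphs of the $FB(d)$-model that is closed under isomorphism, with $P_n$ the set of its members on $[n]$; it is hereditary if $G\setminus\{v\}\in P$ for all $G\in P$ and $v\in V(G)$. It is 1-sided error strongly testable if there is a function $Q:(0,1)\to\mathbb N$ such that for all $\epsilon\in(0,1)$ and $n\in\mathbb N$ there is a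 randomized algorithm (it may depend on $\epsilon$ and $n$) that makes at most $Q(\epsilon)$ queries on every $n$-vertex digraph of the model and in every run, accepts every $G\in P_n$ with probability $1$, and rejects every $n$-vertex digraph of the model that is $\epsilon$-far from $P_n$ with probability at least $1/2$. For a set $\mathcal H$ of digraphs, let $P^*_{\mathcal H_n}$ be the set of digraphs on $[n]$ in the $FB(d)$-model that have no induced subgraph isomorphic to a member of $\mathcal H$. Call $\mathcal H$ an $r$-set if each of its members has at most $r$ vertices. **Theorem.** Let $P=\bigcup_n P_n$ be a hereditary digraph property in the $FB(d)$-model. Then $P$ is 1-sided error strongly testable if and only if for every $\epsilon>0$ there are $r=r(\epsilon)\in\mathbb N$, $n^*_\epsilon\in\mathbb N$ and an $r$-set $\mathcal H$ of digraphs such that for every $n>n^*_\epsilon$: (a) $P_n\subseteq P^*_{\mathcal H_n}$, and (b) $P^*_{\mathcal H_n}$ is $\epsilon/2$-close to $P_n$. -/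

import Mathlib

namespace BoundedDegree

/-- A digraph on the vertex set `V`: anti-parallel edges are allowed, multiple edges and
loops are not. -/
@[ext]
structure SDigraph (V : Type) extends Digraph V where
  loopless : ∀ v, ¬ Adj v v

namespace SDigraph

variable {V : Type}

/-- The set of outgoing neighbours of `v`. -/
def outNbrs (G : SDigraph V) (v : V) : Set V := {u | G.Adj v u}

/-- The set of incoming neighbours of `v`. -/
def inNbrs (G : SDigraph V) (v : V) : Set V := {u | G.Adj u v}

/-- `G` belongs to the model in which all in-degrees and all out-degrees are at most `d`. -/
def FB (d : ℕ) (G : SDigraph V) : Prop :=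
  ∀ v, (G.outNbrs v).ncard ≤ d ∧ (G.inNbrs v).ncard ≤ d

/-- The digraph obtained from `G` by deleting the vertex `v`. -/
def deleteVertex (G : SDigraph V) (v : V) : SDigraph {u : V // u ≠ v} where
  Adj a b := G.Adj a b
  loopless a := G.loopless a

/-- `G` and `H` are isomorphic. -/
def IsIso {W : Type} (G : SDigraph V) (H : SDigraph W) : Prop :=
  Nonempty (G.Adj ≃r H.Adj)

/-- `G` has an induced subgraph isomorphic to `H`. -/
def HasInduced {W : Type} (G : SDigraph V) (H : SDigraph W) : Prop :=
  Nonempty (H.Adj ↪r G.Adj)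

/-- The number of edges that have to be deleted from or inserted into `G` to obtain `G'`. -/
noncomputable def editDist (G G' : SDigraph V) : ℕ :=
  {e : V × V | ¬ (G.Adj e.1 e.2 ↔ G'.Adj e.1 e.2)}.ncard

end SDigraph

/-- A digraph on the vertex set `{0, …, n - 1}`, for some `n`. -/
abbrev FinDigraph : Type := Σ n : ℕ, SDigraph (Fin n)

/-- The set of `n`-vertex members of a set of digraphs. -/
def slice (P : Set FinDigraph) (n : ℕ) : Set (SDigraph (Fin n)) := {G | ⟨n, G⟩ ∈ P}

/-- `P` is a digraph property in the model with degree bound `d`: a set of digraphs of the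
model that is closed under isomorphism. -/
def IsProperty (d : ℕ) (P : Set FinDigraph) : Prop :=
  (∀ F ∈ P, F.2.FB d) ∧ ∀ F ∈ P, ∀ F' : FinDigraph, F'.2.IsIso F.2 → F' ∈ P

/-- `P` is hereditary: with `G` it contains every `G ∖ {v}`, that is, every digraph on some
`{0, …, m - 1}` that is isomorphic to it. -/
def IsHereditary (P : Set FinDigraph) : Prop :=
  ∀ F ∈ P, ∀ v : Fin F.1, ∀ F' : FinDigraph, F'.2.IsIso (F.2.deleteVertex v) → F' ∈ P

/-- Two `n`-vertex digraphs are `ε`-close: their distance is at most `ε d n`. -/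
def Close (d : ℕ) {n : ℕ} (ε : ℝ) (G G' : SDigraph (Fin n)) : Prop :=
  (G.editDist G' : ℝ) ≤ ε * d * n

/-- `G` is `ε`-close to a set of `n`-vertex digraphs; it is `ε`-far if it is not `ε`-close. -/
def CloseTo (d : ℕ) {n : ℕ} (ε : ℝ) (G : SDigraph (Fin n)) (A : Set (SDigraph (Fin n))) : Prop :=
  ∃ G' ∈ A, Close d ε G G'

/-- Two sets of `n`-vertex digraphs are `ε`-close. -/
def SetsClose (d : ℕ) {n : ℕ} (ε : ℝ) (A B : Set (SDigraph (Fin n))) : Prop :=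
  (∀ G ∈ A, CloseTo d ε G B) ∧ ∀ G ∈ B, CloseTo d ε G A

/-- The property of all digraphs of the model with degree bound `d` that contain no member of
`H` as an induced subgraph. -/
def inducedFree (d : ℕ) (H : Set FinDigraph) : Set FinDigraph :=
  {F | F.2.FB d ∧ ∀ K ∈ H, ¬ F.2.HasInduced K.2}

/-- `H` is an `r`-set: all its members have at most `r` vertices. -/
def IsRSet (r : ℕ) (H : Set FinDigraph) : Prop := ∀ K ∈ H, K.1 ≤ r

/-- A deterministic adaptive algorithm with vertex queries: it either halts with a verdict
(`true` is acceptance), or queries a vertex and continues depending on the answer, which is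
the pair of the sets of outgoing and of incoming neighbours. -/
inductive QueryAlg (V : Type) : Type
  | halt (verdict : Bool) : QueryAlg V
  | query (v : V) (next : Set V → Set V → QueryAlg V) : QueryAlg V

namespace QueryAlg

variable {V : Type}

/-- The verdict on the input `G`. -/
def run (G : SDigraph V) : QueryAlg V → Bool
  | halt b => b
  | query v next => run G (next (G.outNbrs v) (G.inNbrs v))

/-- The number of queries made on the input `G`. -/
def numQueries (G : SDigraph V) : QueryAlg V → ℕ
  | halt _ => 0
  | query v next => numQueries G (next (G.outNbrs v) (G.inNbrs v)) + 1

end QueryAlg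

/-- A randomized algorithm on `n`-vertex digraphs: a probability distribution over
deterministic ones (the choice of the internal coins). -/
abbrev RandAlg (n : ℕ) : Type := PMF (QueryAlg (Fin n))

/-- The probability that `T` returns the verdict `b` on the input `G`. -/
noncomputable def verdictProb {n : ℕ} (T : RandAlg n) (G : SDigraph (Fin n)) (b : Bool) :
    ENNReal :=
  (T.map (QueryAlg.run G)) b

/-- `T` is a 1-sided error `ε`-test for the `n`-vertex digraphs of `P`. -/
def IsOneSidedTest (d : ℕ) (P : Set FinDigraph) (ε : ℝ) (n : ℕ) (T : RandAlg n) : Prop :=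
  (∀ G ∈ slice P n, verdictProb T G true = 1) ∧
  ∀ G : SDigraph (Fin n), G.FB d → ¬ CloseTo d ε G (slice P n) → 1 / 2 ≤ verdictProb T G false

/-- `T` makes at most `q` queries on every input of the model and in every run. -/
def QueriesAtMost (d : ℕ) {n : ℕ} (T : RandAlg n) (q : ℕ) : Prop :=
  ∀ G : SDigraph (Fin n), G.FB d → ∀ t ∈ T.support, t.numQueries G ≤ q

/-- `P` is 1-sided error strongly testable in the model with degree bound `d`: for every
`ε ∈ (0, 1)` there are tests for all `n` whose numbers of queries have a common bound. -/
def OneSidedStronglyTestable (d : ℕ) (P : Set FinDigraph) : Prop :=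
  ∃ Q : Set.Ioo (0 : ℝ) 1 → ℕ, ∀ (ε : Set.Ioo (0 : ℝ) 1) (n : ℕ),
    ∃ T : RandAlg n, IsOneSidedTest d P ε n T ∧ QueriesAtMost d T (Q ε)

end BoundedDegree

namespace BoundedDegree

/-! ### Induced subgraphs, query answers and closed neighbourhoods -/

namespace SDigraph

variable {V : Type}

/-! Necessity. With one-sided error, a run may reject only when its answers fit no member of `P_n`.
A run with q queries depends only on a set `D` of at most q vertices, whose closed neighbourhood has
at most r = q(2d+1) vertices. If the subgraph induced there also occurs in a much larger member of
`P`, bounded degree leaves room to place the remaining vertices away from that copy, and heredity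
turns this placement into a member of `P_n` giving the same answers on `D`
(`exists_agree_of_hasInduced`). So let `H` consist of the patterns on at most r vertices that occur
in no large member of `P`: no run rejects an `H`-free digraph, which is therefore close to `P_n`.

Sufficiency. The test explores balls around random vertices and accepts if and only if some member
of `P_n` fits the answers; one-sidedness is automatic and `H` enters only the analysis. A digraph
ε-far from `P_n` is ε/2-far from being `H`-free. Isolating all roots of rare component patterns
costs too few edges to make it `H`-free, so some `K` in `H` survives and each of its components has
linearly many copies (`exists_frequent`). Random roots of such copies are far apart with probability
bounded below, and then the copies together form an induced `K` (`exists_witness_tuples`,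
`hasInduced_of_rootCopies`). What is seen forces `K`, which no member of `P_n` contains. Constantly
many repetitions bring the probability to 1/2. -/

theorem mem_outNbrs {G : SDigraph V} {u v : V} : u ∈ G.outNbrs v ↔ G.Adj v u := Iff.rfl

theorem mem_inNbrs {G : SDigraph V} {u v : V} : u ∈ G.inNbrs v ↔ G.Adj u v := Iff.rfl

/-- The digraph induced on `W` by a map `W → V`. -/
def comap {W : Type} (f : W → V) (G : SDigraph V) : SDigraph W where
  Adj a b := G.Adj (f a) (f b)
  loopless a := G.loopless (f a)

theorem comap_hasInduced {W : Type} (f : W ↪ V) (G : SDigraph V) : G.HasInduced (G.comap f) :=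
  ⟨⟨f, Iff.rfl⟩⟩

theorem HasInduced.trans {W X : Type} {G : SDigraph V} {G' : SDigraph W} {G'' : SDigraph X}
    (h : G.HasInduced G') (h' : G'.HasInduced G'') : G.HasInduced G'' :=
  h.elim fun f => h'.elim fun g => ⟨g.trans f⟩

/-- `G` and `G'` answer a query of `v` in the same way. -/
def Agree (G G' : SDigraph V) (v : V) : Prop :=
  G'.outNbrs v = G.outNbrs v ∧ G'.inNbrs v = G.inNbrs v

theorem Agree.refl (G : SDigraph V) (v : V) : G.Agree G v := ⟨rfl, rfl⟩

theorem Agree.adj_iff {G G' : SDigraph V} {v : V} (h : G.Agree G' v) (u : V) :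
    G'.Adj v u ↔ G.Adj v u :=
  Set.ext_iff.1 h.1 u

instance [Finite V] : Finite (SDigraph V) :=
  Finite.of_injective (fun G : SDigraph V => G.Adj) fun _ _ h => SDigraph.ext h

section Neighbourhood

variable [Fintype V]

open Classical in
/-- The closed neighbourhood of a set of vertices. -/
noncomputable def nbhd (G : SDigraph V) (S : Finset V) : Finset V :=
  S ∪ Finset.univ.filter fun u => ∃ v ∈ S, G.Adj v u ∨ G.Adj u v

theorem mem_nbhd {G : SDigraph V} {S : Finset V} {u : V} :
    u ∈ G.nbhd S ↔ u ∈ S ∨ ∃ v ∈ S, G.Adj v u ∨ G.Adj u v := by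
  simp [nbhd]

theorem card_nbhd_le {d : ℕ} {G : SDigraph V} (hG : G.FB d) (S : Finset V) :
    (G.nbhd S).card ≤ S.card * (2 * d + 1) := by
  classical
  have hsub : G.nbhd S ⊆
      S.biUnion fun v => {v} ∪ ((G.outNbrs v).toFinset ∪ (G.inNbrs v).toFinset) := by
    intro u hu
    rw [mem_nbhd] at hu
    simp only [Finset.mem_biUnion, Finset.mem_union, Finset.mem_singleton, Set.mem_toFinset,
      mem_outNbrs, mem_inNbrs]
    rcases hu with hu | ⟨v, hv, h⟩
    · exact ⟨u, hu, Or.inl rfl⟩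
    · exact ⟨v, hv, Or.inr h⟩
  refine (Finset.card_le_card hsub).trans (Finset.card_biUnion_le_card_mul _ _ _ fun v _ => ?_)
  have h1 := hG v
  rw [Set.ncard_eq_toFinset_card', Set.ncard_eq_toFinset_card'] at h1
  have h2 := Finset.card_union_le {v} ((G.outNbrs v).toFinset ∪ (G.inNbrs v).toFinset)
  have h3 := Finset.card_union_le (G.outNbrs v).toFinset (G.inNbrs v).toFinset
  rw [Finset.card_singleton] at h2
  omega

end Neighbourhood

end SDigraph

open SDigraph

/-- A hereditary property contains all induced subgraphs of its members. -/
theorem mem_of_hasInduced {d : ℕ} {P : Set FinDigraph} (hP : IsProperty d P)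
    (hher : IsHereditary P) {F F' : FinDigraph} (hF : F ∈ P) (h : F.2.HasInduced F'.2) :
    F' ∈ P := by
  classical
  induction hn : F.1 using Nat.strong_induction_on generalizing F with
  | _ n ih =>
    obtain ⟨f⟩ := h
    by_cases hs : Function.Surjective f
    -- A surjective embedding is an isomorphism; otherwise a missed vertex is deleted, the rest
    -- relabelled, and induction on the order applies.
    · exact hP.2 F hF F' ⟨RelIso.ofSurjective f hs⟩
    · obtain ⟨v, hv⟩ := not_forall.1 hs
      let e := Fintype.equivFin {u : Fin F.1 // u ≠ v}
      let D : FinDigraph := ⟨_, (F.2.deleteVertex v).comap e.symm⟩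
      have hD : D ∈ P := hher F hF v D ⟨⟨e.symm, Iff.rfl⟩⟩
      refine ih D.1 ?_ hD ?_ rfl
      · rw [← hn]
        have : Fintype.card {u : Fin F.1 // u ≠ v} < Fintype.card (Fin F.1) :=
          Fintype.card_subtype_lt (x := v) (by simp)
        simpa [D] using this
      · refine ⟨⟨⟨fun a => e ⟨f a, fun h => hv ⟨a, h⟩⟩, fun a b hab => ?_⟩, fun {a b} => ?_⟩⟩
        · simpa using hab
        · change F.2.Adj (e.symm (e _)) (e.symm (e _)) ↔ _
          rw [Equiv.symm_apply_apply, Equiv.symm_apply_apply]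
          exact f.map_rel_iff

/-! ### Query algorithms and exploration in rounds -/

namespace QueryAlg

variable {V : Type}

/-- The vertices queried on the input `G`. -/
def queried (G : SDigraph V) : QueryAlg V → List V
  | halt _ => []
  | query v next => v :: queried G (next (G.outNbrs v) (G.inNbrs v))

theorem length_queried (G : SDigraph V) (t : QueryAlg V) :
    (t.queried G).length = t.numQueries G := by
  induction t with
  | halt b => rfl
  | query v next ih => simp [queried, numQueries, ih]

/-- Adaptivity is harmless: as long as the answers coincide, so does the next query, hence only the
vertices queried on `G` matter. -/
theorem run_congr {G G' : SDigraph V} (t : QueryAlg V) (h : ∀ v ∈ t.queried G, G.Agree G' v) :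
    t.run G' = t.run G := by
  induction t with
  | halt b => rfl
  | query v next ih =>
    simp only [queried, List.mem_cons, forall_eq_or_imp] at h
    simp only [run, h.1.1, h.1.2]
    exact ih _ _ h.2

variable [Fintype V]

open Classical in
/-- Query the vertices of a list, adding their neighbours to the set `S` and removing from `A`
the digraphs that are inconsistent with the answers; then continue with `k`. -/
noncomputable def askList : List V → Finset V → Set (SDigraph V) →
    (Finset V → Set (SDigraph V) → QueryAlg V) → QueryAlg V
  | [], S, A, k => k S A
  | v :: L, S, A, k => query v fun o i =>
      askList L (S ∪ (o.toFinset ∪ i.toFinset)) {G | G ∈ A ∧ G.outNbrs v = o ∧ G.inNbrs v = i} k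

open Classical in
/-- Query the vertices of `S` and repeatedly all neighbours of queried vertices, in `ρ` rounds,
and accept if and only if a digraph of `A` is consistent with all the answers. -/
noncomputable def explore : ℕ → Finset V → Set (SDigraph V) → QueryAlg V
  | 0, _, A => halt (decide A.Nonempty)
  | ρ + 1, S, A => askList S.toList S A (explore ρ)

open Classical in
/-- The set of vertices queried by `explore`. -/
noncomputable def explored (G : SDigraph V) : ℕ → Finset V → Finset V
  | 0, _ => ∅
  | ρ + 1, S => S ∪ explored G ρ (G.nbhd S)

/-- A bound on the number of queries made by `explore` when starting from `s` vertices. -/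
def exploreCost (d : ℕ) : ℕ → ℕ → ℕ
  | 0, _ => 0
  | ρ + 1, s => s + exploreCost d ρ (s * (2 * d + 1))

theorem exploreCost_mono (d ρ : ℕ) {s s' : ℕ} (h : s ≤ s') :
    exploreCost d ρ s ≤ exploreCost d ρ s' := by
  induction ρ generalizing s s' with
  | zero => rfl
  | succ ρ ih => exact Nat.add_le_add h (ih (Nat.mul_le_mul_right _ h))

open Classical in
theorem run_askList (G : SDigraph V) (L : List V) (S : Finset V) (A : Set (SDigraph V))
    (k : Finset V → Set (SDigraph V) → QueryAlg V) :
    (askList L S A k).run G =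
        (k (S ∪ Finset.univ.filter fun u => ∃ v ∈ L, G.Adj v u ∨ G.Adj u v)
          {G' | G' ∈ A ∧ ∀ v ∈ L, G.Agree G' v}).run G ∧
      (askList L S A k).numQueries G = L.length +
        (k (S ∪ Finset.univ.filter fun u => ∃ v ∈ L, G.Adj v u ∨ G.Adj u v)
          {G' | G' ∈ A ∧ ∀ v ∈ L, G.Agree G' v}).numQueries G := by
  induction L generalizing S A with
  | nil => simp [askList]
  | cons v L ih =>
    have hS : S ∪ ((G.outNbrs v).toFinset ∪ (G.inNbrs v).toFinset) ∪
          Finset.univ.filter (fun u => ∃ w ∈ L, G.Adj w u ∨ G.Adj u w) =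
        S ∪ Finset.univ.filter fun u => ∃ w ∈ v :: L, G.Adj w u ∨ G.Adj u w := by
      ext u
      simp [mem_outNbrs, mem_inNbrs, or_assoc]
    have hA : {G' | G' ∈ {G' | G' ∈ A ∧ G'.outNbrs v = G.outNbrs v ∧ G'.inNbrs v = G.inNbrs v} ∧
          ∀ w ∈ L, G.Agree G' w} =
        {G' | G' ∈ A ∧ ∀ w ∈ v :: L, G.Agree G' w} := by
      ext G'
      simp [Agree, and_assoc]
    simp only [askList, run, numQueries, ih, hS, hA, List.length_cons, true_and]
    omega

open Classical in
theorem union_filter_toList (G : SDigraph V) (S : Finset V) :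
    (S ∪ Finset.univ.filter fun u => ∃ v ∈ S.toList, G.Adj v u ∨ G.Adj u v) = G.nbhd S := by
  ext u
  simp [mem_nbhd]

/-- The candidates surviving all rounds are exactly those that agree with `G` on every explored
vertex. -/
theorem run_explore (G : SDigraph V) (ρ : ℕ) (S : Finset V) (A : Set (SDigraph V)) :
    (explore ρ S A).run G = true ↔ ∃ G' ∈ A, ∀ v ∈ explored G ρ S, G.Agree G' v := by
  induction ρ generalizing S A with
  | zero => simp [explore, explored, run, Set.nonempty_def]
  | succ ρ ih =>
    rw [explore, (run_askList _ _ _ _ _).1, union_filter_toList, ih]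
    simp only [Finset.mem_toList, Set.mem_ofPred_eq, explored, Finset.mem_union]
    constructor
    · rintro ⟨G', ⟨h1, h2⟩, h3⟩
      exact ⟨G', h1, fun v hv => hv.elim (h2 v) (h3 v)⟩
    · rintro ⟨G', h1, h2⟩
      exact ⟨G', ⟨h1, fun v hv => h2 v (Or.inl hv)⟩, fun v hv => h2 v (Or.inr hv)⟩

theorem numQueries_explore_le {d : ℕ} {G : SDigraph V} (hG : G.FB d) (ρ : ℕ) (S : Finset V)
    (A : Set (SDigraph V)) : (explore ρ S A).numQueries G ≤ exploreCost d ρ S.card := by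
  induction ρ generalizing S A with
  | zero => simp [explore, exploreCost, numQueries]
  | succ ρ ih =>
    rw [explore, (run_askList _ _ _ _ _).2, exploreCost, Finset.length_toList]
    refine Nat.add_le_add_left ((ih _ _).trans (exploreCost_mono _ _ ?_)) _
    rw [union_filter_toList]
    exact card_nbhd_le hG S

end QueryAlg

/-! ### Testable properties are nearly characterised by forbidden induced subgraphs -/

theorem Close.mono {d n : ℕ} {ε ε' : ℝ} (h : ε ≤ ε') {G G' : SDigraph (Fin n)}
    (hG : Close d ε G G') : Close d ε' G G' :=
  le_trans hG (by gcongr)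

theorem editDist_self {V : Type} (G : SDigraph V) : G.editDist G = 0 := by
  simp [editDist]

theorem editDist_triangle {V : Type} [Finite V] (G₁ G₂ G₃ : SDigraph V) :
    G₁.editDist G₃ ≤ G₁.editDist G₂ + G₂.editDist G₃ := by
  refine (Set.ncard_le_ncard ?_ (Set.toFinite _)).trans (Set.ncard_union_le _ _)
  intro e he
  simp only [Set.mem_union, Set.mem_ofPred_eq] at he ⊢
  tauto

theorem Close.refl {d n : ℕ} {ε : ℝ} (hε : 0 ≤ ε) (G : SDigraph (Fin n)) : Close d ε G G := by
  rw [Close, editDist_self, Nat.cast_zero]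
  positivity

/-- If the subgraph of `G` induced by the closed neighbourhood of `D` is an induced subgraph of
a large member of a hereditary property, then the property has a member of the same size as `G`
that cannot be distinguished from `G` by querying the vertices of `D`. -/
theorem exists_agree_of_hasInduced {d n N q : ℕ} {P : Set FinDigraph} (hP : IsProperty d P)
    (hher : IsHereditary P) (G : SDigraph (Fin n)) (D A : Finset (Fin n)) (hA : A.card ≤ q)
    (hDA : G.nbhd D ⊆ A) (F : SDigraph (Fin N)) (hF : ⟨N, F⟩ ∈ P)
    (hN : n + q * (2 * d + 1) ≤ N) (h : F.HasInduced (G.comap (Subtype.val : A → Fin n))) :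
    ∃ G' ∈ slice P n, ∀ v ∈ D, G.Agree G' v := by
  classical
  obtain ⟨f⟩ := h
  let B := F.nbhd (Finset.univ.map f.toEmbedding)
  have hB : B.card ≤ q * (2 * d + 1) := by
    refine (card_nbhd_le (hP.1 _ hF) _).trans (Nat.mul_le_mul_right _ ?_)
    simpa using hA
  have hfB : ∀ a, f a ∈ B := fun a =>
    mem_nbhd.2 (Or.inl (Finset.mem_map_of_mem _ (Finset.mem_univ a)))
  have hB' : ∀ a y, y ∉ B → ¬ F.Adj (f a) y ∧ ¬ F.Adj y (f a) := fun a y hy => by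
    rw [← not_or]
    exact fun h => hy (mem_nbhd.2 (Or.inr ⟨f a, Finset.mem_map_of_mem _ (Finset.mem_univ a), h⟩))
  -- At least `n` vertices of `F` lie outside `B`, enough to host everything outside `A` without
  -- edges to the copy of `A`.
  obtain ⟨h⟩ : Nonempty ({x : Fin n // x ∉ A} ↪ {y : Fin N // y ∉ B}) := by
    refine Function.Embedding.nonempty_of_card_le ?_
    have h1 : Fintype.card {x : Fin n // x ∉ A} ≤ n := by
      simpa only [Fintype.card_fin] using Fintype.card_subtype_le fun x : Fin n => x ∉ A
    have h2 : Fintype.card {y : Fin N // y ∉ B} = N - B.card := by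
      simp [Fintype.card_subtype_compl]
    omega
  let g : Fin n → Fin N := fun x => if hx : x ∈ A then f ⟨x, hx⟩ else h ⟨x, hx⟩
  have gA : ∀ x (hx : x ∈ A), g x = f ⟨x, hx⟩ := fun x hx => dif_pos hx
  have gB : ∀ x (_ : x ∉ A), g x ∉ B := fun x hx => by
    simp only [g, dif_neg hx]
    exact (h ⟨x, hx⟩).2
  have gi : Function.Injective g := by
    intro x y hxy
    by_cases hx : x ∈ A <;> by_cases hy : y ∈ A
    · rw [gA x hx, gA y hy] at hxy
      simpa using hxy
    · exact absurd (hxy ▸ gA x hx ▸ hfB ⟨x, hx⟩) (gB y hy)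
    · exact absurd (hxy.symm ▸ gA y hy ▸ hfB ⟨y, hy⟩) (gB x hx)
    · simp only [g, dif_neg hx, dif_neg hy] at hxy
      simpa using h.injective (Subtype.ext hxy)
  refine ⟨F.comap g, mem_of_hasInduced hP hher hF (comap_hasInduced ⟨g, gi⟩ F), fun v hv => ?_⟩
  have hvA : v ∈ A := hDA (mem_nbhd.2 (Or.inl hv))
  have key : ∀ u, (F.Adj (g v) (g u) ↔ G.Adj v u) ∧ (F.Adj (g u) (g v) ↔ G.Adj u v) := by
    intro u
    by_cases hu : u ∈ A
    · rw [gA v hvA, gA u hu]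
      exact ⟨f.map_rel_iff, f.map_rel_iff⟩
    -- Both sides are non-edges: `A` contains all `G`-neighbours of `v`, and `g u` avoids the closed
    -- neighbourhood of the copy.
    · have h1 : ¬ (G.Adj v u ∨ G.Adj u v) := fun h =>
        hu (hDA (mem_nbhd.2 (Or.inr ⟨v, hv, h⟩)))
      have h2 := hB' ⟨v, hvA⟩ _ (gB u hu)
      rw [← gA v hvA] at h2
      tauto
  exact ⟨Set.ext fun u => (key u).1, Set.ext fun u => (key u).2⟩

theorem finite_setOf_fst_le (r : ℕ) : {K : FinDigraph | K.1 ≤ r}.Finite := by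
  have : {K : FinDigraph | K.1 ≤ r} ⊆
      Set.range fun x : Σ m : Fin (r + 1), SDigraph (Fin m) => (⟨x.1, x.2⟩ : FinDigraph) := by
    rintro ⟨m, K⟩ hm
    exact ⟨⟨⟨m, Nat.lt_succ_of_le hm⟩, K⟩, rfl⟩
  exact (Set.finite_range _).subset this

/-- Of the bound 1/2 only positivity is used. -/
theorem exists_reject_run {d n : ℕ} {P : Set FinDigraph} {ε : ℝ} {T : RandAlg n}
    (hT : IsOneSidedTest d P ε n T) {G : SDigraph (Fin n)} (hG : G.FB d)
    (hfar : ¬ CloseTo d ε G (slice P n)) : ∃ t ∈ T.support, t.run G = false := by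
  have h := hT.2 G hG hfar
  have h0 : false ∈ (T.map (QueryAlg.run G)).support := by
    rw [PMF.mem_support_iff]
    intro h0
    rw [verdictProb, h0] at h
    simp at h
  simpa using h0

theorem run_eq_true_of_mem {d n : ℕ} {P : Set FinDigraph} {ε : ℝ} {T : RandAlg n}
    (hT : IsOneSidedTest d P ε n T) {G : SDigraph (Fin n)} (hG : G ∈ slice P n)
    {t : QueryAlg (Fin n)} (ht : t ∈ T.support) : t.run G = true := by
  have h := (PMF.apply_eq_one_iff _ _).1 (hT.1 G hG)
  have : t.run G ∈ (T.map (QueryAlg.run G)).support := by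
    rw [PMF.mem_support_map_iff]
    exact ⟨t, ht, rfl⟩
  rw [h] at this
  exact this

theorem exists_forbidden_of_testable {d : ℕ} {P : Set FinDigraph} (hP : IsProperty d P)
    (hher : IsHereditary P) (h : OneSidedStronglyTestable d P) {ε : ℝ} (hε : 0 < ε) :
    ∃ (r nstar : ℕ) (H : Set FinDigraph), IsRSet r H ∧ ∀ n : ℕ, nstar < n →
      slice P n ⊆ slice (inducedFree d H) n ∧
      SetsClose d (ε / 2) (slice (inducedFree d H) n) (slice P n) := by
  classical
  obtain ⟨Q, hQ⟩ := h
  -- Tests exist only for parameters below 1, while `ε` is arbitrary.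
  let δ : Set.Ioo (0 : ℝ) 1 := ⟨min (ε / 2) (1 / 2), by
    constructor
    · positivity
    · exact (min_le_right _ _).trans_lt (by norm_num)⟩
  let r := Q δ * (2 * d + 1)
  -- Either `K` occurs in arbitrarily large members, or the orders of the members containing it are
  -- bounded. Only finitely many `K` have at most `r` vertices, so one threshold `nstar` serves them
  -- all.
  have hbd : ∀ K : FinDigraph, ∃ N₀ : ℕ, ∀ F ∈ P, F.2.HasInduced K.2 → N₀ < F.1 →
      ∀ N, ∃ F ∈ P, N ≤ F.1 ∧ F.2.HasInduced K.2 := by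
    intro K
    by_contra! hK
    obtain ⟨_, _, _, _, N, hN⟩ := hK 0
    obtain ⟨F, hF, hFK, hNF, _⟩ := hK N
    exact hN F hF hNF.le hFK
  choose N₀ hN₀ using hbd
  obtain ⟨nstar, hnstar⟩ := ((finite_setOf_fst_le r).image N₀).bddAbove
  let H : Set FinDigraph := {K | K.1 ≤ r ∧ ∀ F ∈ P, nstar < F.1 → ¬ F.2.HasInduced K.2}
  refine ⟨r, nstar, H, fun K hK => hK.1, fun n hn => ?_⟩
  have hsub : slice P n ⊆ slice (inducedFree d H) n := fun G hG =>
    ⟨hP.1 _ hG, fun K hK => hK.2 _ hG hn⟩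
  refine ⟨hsub, fun G hG => ?_, fun G hG => ⟨G, hsub hG, Close.refl (by positivity) G⟩⟩
  obtain ⟨T, hT, hq⟩ := hQ δ n
  by_contra hfar
  have hfar' : ¬ CloseTo d δ G (slice P n) := fun ⟨G', hG', h⟩ =>
    hfar ⟨G', hG', h.mono (min_le_left _ _)⟩
  obtain ⟨t, ht, hrun⟩ := exists_reject_run hT hG.1 hfar'
  let D := (t.queried G).toFinset
  have hD : (G.nbhd D).card ≤ r := by
    refine (card_nbhd_le hG.1 D).trans (Nat.mul_le_mul_right _ ?_)
    refine (List.toFinset_card_le _).trans ?_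
    rw [QueryAlg.length_queried]
    exact hq G hG.1 t ht
  let e : Fin (G.nbhd D).card ≃ G.nbhd D := (G.nbhd D).equivFin.symm
  let G₀ := G.comap (Subtype.val : G.nbhd D → Fin n)
  let K : FinDigraph := ⟨_, G₀.comap e⟩
  have hGK : G.HasInduced K.2 :=
    (comap_hasInduced (Function.Embedding.subtype _) G).trans
      (comap_hasInduced e.toEmbedding G₀)
  have hKH : K ∉ H := fun hK => hG.2 K hK hGK
  obtain ⟨F, hF, hnF, hFK⟩ : ∃ F ∈ P, nstar < F.1 ∧ F.2.HasInduced K.2 := by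
    by_contra! hc
    exact hKH ⟨hD, hc⟩
  obtain ⟨F', hF', hle, hFK'⟩ := hN₀ K F hF hFK
    ((hnstar (Set.mem_image_of_mem _ hD)).trans_lt hnF) (n + r * (2 * d + 1))
  have hKG₀ : K.2.HasInduced G₀ := ⟨⟨e.symm.toEmbedding, by simp [K, comap]⟩⟩
  obtain ⟨G', hG', hag⟩ := exists_agree_of_hasInduced hP hher G D (G.nbhd D) hD subset_rfl
    F'.2 hF' hle (hFK'.trans hKG₀)
  have h1 := run_eq_true_of_mem hT hG' ht
  rw [t.run_congr fun v hv => hag v (List.mem_toFinset.2 hv), hrun] at h1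
  exact Bool.false_ne_true h1

/-! ### Distances, rooted copies of components, and isolating vertices -/

namespace SDigraph

variable {V : Type}

/-- The underlying undirected graph. -/
def und (G : SDigraph V) : SimpleGraph V where
  Adj u v := G.Adj u v ∨ G.Adj v u
  symm := ⟨fun _ _ => Or.symm⟩
  loopless := ⟨fun v h => h.elim (G.loopless v) (G.loopless v)⟩

/-- The distance of `u` and `v` in the underlying undirected graph is at most `k`. -/
def Within (G : SDigraph V) (k : ℕ) (u v : V) : Prop := ∃ p : G.und.Walk u v, p.length ≤ k

theorem Within.refl (G : SDigraph V) (k : ℕ) (u : V) : G.Within k u u :=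
  ⟨.nil, Nat.zero_le k⟩

theorem Within.symm {G : SDigraph V} {k : ℕ} {u v : V} (h : G.Within k u v) : G.Within k v u :=
  h.elim fun p hp => ⟨p.reverse, by simpa using hp⟩

theorem Within.trans {G : SDigraph V} {k l : ℕ} {u v w : V} (h : G.Within k u v)
    (h' : G.Within l v w) : G.Within (k + l) u w := by
  obtain ⟨p, hp⟩ := h
  obtain ⟨q, hq⟩ := h'
  exact ⟨p.append q, by rw [SimpleGraph.Walk.length_append]; omega⟩

theorem Within.mono {G : SDigraph V} {k l : ℕ} (hkl : k ≤ l) {u v : V} (h : G.Within k u v) :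
    G.Within l u v :=
  h.elim fun p hp => ⟨p, hp.trans hkl⟩

theorem within_one_of_adj {G : SDigraph V} {u v : V} (h : G.und.Adj u v) : G.Within 1 u v :=
  ⟨.cons h .nil, by simp⟩

theorem within_succ {G : SDigraph V} {k : ℕ} {u v : V} (h : G.Within (k + 1) u v) :
    u = v ∨ ∃ w, G.und.Adj u w ∧ G.Within k w v := by
  obtain ⟨p, hp⟩ := h
  cases p with
  | nil => exact Or.inl rfl
  | cons h p => exact Or.inr ⟨_, h, p, by simpa using hp⟩

/-- A path in `K` has fewer than `m` edges, and `f` maps it to a walk in `G`. -/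
theorem within_of_reachable {m : ℕ} {G : SDigraph V} {K : SDigraph (Fin m)} {i : Fin m}
    {f : Fin m → V}
    (hf : ∀ a b, K.und.Reachable i a → K.und.Reachable i b → K.Adj a b → G.Adj (f a) (f b))
    {a : Fin m} (ha : K.und.Reachable i a) : G.Within m (f i) (f a) := by
  have key : ∀ (a b : Fin m) (p : K.und.Walk a b), K.und.Reachable i a →
      G.Within p.length (f a) (f b) := by
    intro a b p
    induction p with
    | nil => exact fun _ => Within.refl _ _ _
    | cons h p ih =>
      intro hi
      have hi' := hi.trans h.reachable
      rw [SimpleGraph.Walk.length_cons, Nat.add_comm]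
      exact (within_one_of_adj (h.imp (hf _ _ hi hi') (hf _ _ hi' hi))).trans (ih hi')
  obtain ⟨p, hp⟩ := ha.exists_isPath
  have hl := hp.length_lt
  rw [Fintype.card_fin] at hl
  exact (key i a p (SimpleGraph.Reachable.refl i)).mono hl.le

section Fintype

variable [Fintype V]

theorem card_within_le {d : ℕ} {G : SDigraph V} (hG : G.FB d) (k : ℕ) (u : V)
    [DecidablePred (G.Within k u)] :
    (Finset.univ.filter (G.Within k u)).card ≤ (2 * d + 1) ^ k := by
  classical
  induction k generalizing u with
  | zero =>
    rw [pow_zero, Finset.card_le_one]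
    have : ∀ v, G.Within 0 u v → u = v := fun v ⟨p, hp⟩ =>
      SimpleGraph.Walk.eq_of_length_eq_zero (Nat.le_zero.1 hp)
    intro a ha b hb
    rw [← this a (Finset.mem_filter.1 ha).2, ← this b (Finset.mem_filter.1 hb).2]
  | succ k ih =>
    have hsub : Finset.univ.filter (G.Within (k + 1) u) ⊆
        (G.nbhd {u}).biUnion fun w => Finset.univ.filter (G.Within k w) := by
      intro v hv
      simp only [Finset.mem_biUnion, Finset.mem_filter, Finset.mem_univ, true_and, mem_nbhd,
        Finset.mem_singleton, exists_eq_left] at hv ⊢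
      rcases within_succ hv with rfl | ⟨w, hw, h⟩
      · exact ⟨u, Or.inl rfl, Within.refl _ _ _⟩
      · exact ⟨w, Or.inr hw, h⟩
    refine (Finset.card_le_card hsub).trans
      ((Finset.card_biUnion_le_card_mul _ _ _ fun w _ => ih w).trans ?_)
    rw [pow_succ']
    exact Nat.mul_le_mul_right _ (by simpa using card_nbhd_le hG {u})

/-- Each round moves the frontier one step. The inequality is strict because the first round queries
only `S`, at distance 0. -/
theorem mem_explored {G : SDigraph V} {ρ k : ℕ} (hk : k < ρ) {S : Finset V} {s u : V}
    (hs : s ∈ S) (h : G.Within k s u) : u ∈ QueryAlg.explored G ρ S := by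
  classical
  induction ρ generalizing S s k with
  | zero => omega
  | succ ρ ih =>
    rw [QueryAlg.explored, Finset.mem_union]
    obtain ⟨p, hp⟩ := h
    cases p with
    | nil => exact Or.inl hs
    | cons h p =>
      rw [SimpleGraph.Walk.length_cons] at hp
      exact Or.inr (ih (k := k - 1) (by omega) (mem_nbhd.2 (Or.inr ⟨_, hs, h⟩))
        ⟨p, by omega⟩)

open Classical in
/-- The images of the vertex `i` under the embeddings of the connected component of `i` in `K`
as an induced subgraph of `G`. -/
noncomputable def rootCopies {m : ℕ} (G : SDigraph V) (K : SDigraph (Fin m)) (i : Fin m) :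
    Finset V :=
  Finset.univ.filter fun v => ∃ f : Fin m → V, f i = v ∧
    ∀ a b, K.und.Reachable i a → K.und.Reachable i b →
      (f a = f b → a = b) ∧ (G.Adj (f a) (f b) ↔ K.Adj a b)

theorem mem_rootCopies {m : ℕ} {G : SDigraph V} {K : SDigraph (Fin m)} {i : Fin m} {v : V} :
    v ∈ G.rootCopies K i ↔ ∃ f : Fin m → V, f i = v ∧
      ∀ a b, K.und.Reachable i a → K.und.Reachable i b →
        (f a = f b → a = b) ∧ (G.Adj (f a) (f b) ↔ K.Adj a b) := by
  simp [rootCopies]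

theorem rootCopies_eq_univ_of_isolated {m : ℕ} (G : SDigraph V) {K : SDigraph (Fin m)}
    {i : Fin m} (hi : ∀ j, ¬ K.und.Adj i j) : G.rootCopies K i = Finset.univ := by
  have hr : ∀ a, K.und.Reachable i a → a = i := by
    rintro a ⟨p⟩
    cases p with
    | nil => rfl
    | cons h p => exact absurd h (hi _)
  refine Finset.eq_univ_of_forall fun v => mem_rootCopies.2 ⟨fun _ => v, rfl, fun a b ha hb => ?_⟩
  rw [hr a ha, hr b hb]
  exact ⟨fun _ => rfl, iff_of_false (G.loopless v) (K.loopless i)⟩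

/-- If far apart vertices of `G` are roots of copies of the components of `K`, then `K` is an
induced subgraph of every digraph that agrees with `G` in the vicinity of the roots. -/
theorem hasInduced_of_rootCopies {m r : ℕ} (hm : m ≤ r) {G G' : SDigraph V}
    {K : SDigraph (Fin m)} {x : Fin m → V} (hx : ∀ i, x i ∈ G.rootCopies K i)
    (hfar : ∀ i j, i ≠ j → ¬ G.Within (2 * r + 1) (x i) (x j))
    (hag : ∀ i u, G.Within r (x i) u → G.Agree G' u) : G'.HasInduced K := by
  choose f hfx hf using fun i => mem_rootCopies.1 (hx i)
  -- Every vertex of `K` has a root, but only one root per component is used to build the embedding.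
  let rep : Fin m → Fin m := fun a => (K.und.connectedComponentMk a).out
  have hrep : ∀ a, K.und.Reachable (rep a) a := fun a =>
    SimpleGraph.ConnectedComponent.exact (Quot.out_eq _)
  have hw : ∀ a, G.Within r (x (rep a)) (f (rep a) a) := fun a => by
    rw [← hfx (rep a)]
    exact (within_of_reachable (fun b c hb hc => (hf _ b c hb hc).2.2) (hrep a)).mono hm
  -- Radius `r` on both sides plus one edge gives 2r+1. This excludes both overlaps and edges
  -- between copies of different components.
  have hne : ∀ a b, G.Within 1 (f (rep a) a) (f (rep b) b) → rep a = rep b := by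
    intro a b hab
    by_contra hne
    refine hfar _ _ hne ((((hw a).trans hab).trans (hw b).symm).mono ?_)
    omega
  have hadj : ∀ a b, G'.Adj (f (rep a) a) (f (rep b) b) ↔ K.Adj a b := by
    intro a b
    rw [(hag _ _ (hw a)).adj_iff]
    by_cases hab : rep a = rep b
    · have h := (hf (rep b) a b (hab ▸ hrep a) (hrep b)).2
      rw [hab, h]
    · refine iff_of_false (fun h => hab (hne a b (within_one_of_adj (Or.inl h)))) fun h => hab ?_
      have : K.und.Adj a b := Or.inl h
      simp only [rep, SimpleGraph.ConnectedComponent.eq.2 this.reachable]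
  refine ⟨⟨⟨fun a => f (rep a) a, fun a b hab => ?_⟩, hadj _ _⟩⟩
  have h : rep a = rep b := hne a b (by
    rw [show f (rep a) a = f (rep b) b from hab]
    exact Within.refl _ _ _)
  refine (hf (rep b) a b (h ▸ hrep a) (hrep b)).1 ?_
  rw [← h]
  exact hab.trans (by rw [h])

/-- The digraph obtained from `G` by deleting all edges at the vertices of `R`. -/
def isolate (G : SDigraph V) (R : Finset V) : SDigraph V where
  Adj u v := G.Adj u v ∧ u ∉ R ∧ v ∉ R
  loopless v h := G.loopless v h.1

theorem FB.isolate {d : ℕ} {G : SDigraph V} (hG : G.FB d) (R : Finset V) :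
    (G.isolate R).FB d := fun v =>
  ⟨(Set.ncard_le_ncard (fun _ h => h.1) (Set.toFinite _)).trans (hG v).1,
    (Set.ncard_le_ncard (fun _ h => h.1) (Set.toFinite _)).trans (hG v).2⟩

theorem editDist_isolate_le {d : ℕ} {G : SDigraph V} (hG : G.FB d) (R : Finset V) :
    G.editDist (G.isolate R) ≤ R.card * (2 * d) := by
  classical
  rw [editDist, Set.ncard_eq_toFinset_card']
  have hsub : {e : V × V | ¬ (G.Adj e.1 e.2 ↔ (G.isolate R).Adj e.1 e.2)}.toFinset ⊆
      R.biUnion fun v => (G.outNbrs v).toFinset.image (fun u => (v, u)) ∪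
        (G.inNbrs v).toFinset.image (fun u => (u, v)) := by
    rintro ⟨u, v⟩ h
    rw [Set.mem_toFinset, Set.mem_ofPred_eq] at h
    simp only [isolate] at h
    simp only [Finset.mem_biUnion, Finset.mem_union, Finset.mem_image, Set.mem_toFinset,
      mem_outNbrs, mem_inNbrs, Prod.mk.injEq]
    by_cases hu : u ∈ R
    · exact ⟨u, hu, Or.inl ⟨v, by tauto, rfl, rfl⟩⟩
    · exact ⟨v, by tauto, Or.inr ⟨u, by tauto, rfl, rfl⟩⟩
  refine (Finset.card_le_card hsub).trans (Finset.card_biUnion_le_card_mul _ _ _ fun v _ => ?_)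
  have h1 := hG v
  rw [Set.ncard_eq_toFinset_card', Set.ncard_eq_toFinset_card'] at h1
  refine (Finset.card_union_le _ _).trans ?_
  have h2 := Finset.card_image_le (s := (G.outNbrs v).toFinset) (f := fun u => (v, u))
  have h3 := Finset.card_image_le (s := (G.inNbrs v).toFinset) (f := fun u => (u, v))
  omega

/-- If `K` is an induced subgraph of the digraph obtained by isolating `R`, then every vertex of
`K` that is not isolated has a copy outside `R`. -/
theorem exists_rootCopy_notMem {m : ℕ} {G : SDigraph V} {R : Finset V}
    {K : SDigraph (Fin m)} (h : (G.isolate R).HasInduced K) {i j : Fin m} (hij : K.und.Adj i j) :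
    ∃ v ∈ G.rootCopies K i, v ∉ R := by
  obtain ⟨f⟩ := h
  have hR : ∀ a b, K.und.Adj a b → f a ∉ R := by
    rintro a b (h | h)
    · exact (f.map_rel_iff.2 h).2.1
    · exact (f.map_rel_iff.2 h).2.2
  have hR' : ∀ a, K.und.Reachable i a → f a ∉ R := by
    rintro a ⟨p⟩
    -- The first edge of the walk from `a` back to `i` shows that `a` is not isolated; if `a` is `i`
    -- itself, `j` does.
    cases p.reverse with
    | nil => exact hR _ _ hij
    | cons h p => exact hR _ _ h
  refine ⟨f i, mem_rootCopies.2 ⟨f, rfl, fun a b ha hb => ⟨fun h => f.injective h, ?_⟩⟩,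
    hR i j hij⟩
  rw [← f.map_rel_iff]
  exact ⟨fun h => ⟨h, hR' a ha, hR' b hb⟩, fun h => h.1⟩

end Fintype

end SDigraph

/-! ### Counting -/

open Classical in
/-- A lower bound for the number of tuples with entries in prescribed large sets that are pairwise
unrelated with respect to a relation of bounded degree. -/
theorem pow_le_card_unrelated {V : Type} [Fintype V] (R : V → V → Prop) (a B : ℕ)
    (hB : ∀ v, (Finset.univ.filter (R v)).card ≤ B) (r : ℕ) (W : Fin r → Finset V)
    (hW : ∀ i, a + r * B ≤ (W i).card) :
    a ^ r ≤ (Finset.univ.filter fun x : Fin r → V =>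
      (∀ i, x i ∈ W i) ∧ ∀ i j, i < j → ¬ R (x i) (x j)).card := by
  induction r with
  | zero => simp
  | succ r ih =>
    let T : V → Finset (Fin r → V) := fun v => Finset.univ.filter fun x =>
      (∀ i, x i ∈ W i.succ \ Finset.univ.filter (R v)) ∧ ∀ i j, i < j → ¬ R (x i) (x j)
    -- Fixing the first entry `v` costs each later set at most `B` elements, which is the surplus
    -- lost in passing from `r + 1` to `r`.
    have hT : ∀ v ∈ W 0, a ^ r ≤ (T v).card := fun v _ => ih _ fun i => by
      have h1 := hW i.succ
      have h2 := hB v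
      have h3 := Finset.le_card_sdiff (Finset.univ.filter (R v)) (W i.succ)
      rw [Nat.add_mul, one_mul] at h1
      omega
    calc a ^ (r + 1) = a * a ^ r := pow_succ' a r
      _ ≤ (W 0).card * a ^ r :=
        Nat.mul_le_mul_right _ ((Nat.le_add_right _ _).trans (hW 0))
      _ ≤ ∑ v ∈ W 0, (T v).card := by
        simpa using Finset.card_nsmul_le_sum (W 0) (fun v => (T v).card) (a ^ r) hT
      _ = ((W 0).sigma T).card := (Finset.card_sigma _ _).symm
      _ ≤ _ := by
        refine Finset.card_le_card_of_injOn (fun p => Fin.cons p.1 p.2) ?_ ?_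
        · rintro ⟨v, x⟩ h
          simp only [Finset.coe_sigma, Set.mem_sigma_iff, Finset.mem_coe, T, Finset.mem_filter,
            Finset.mem_univ, true_and, Finset.mem_sdiff] at h
          obtain ⟨hv, hx, hx'⟩ := h
          simp only [Finset.mem_coe, Finset.mem_filter, Finset.mem_univ, true_and]
          refine ⟨Fin.cases hv fun i => (hx i).1, ?_⟩
          refine Fin.cases (Fin.cases (fun h => absurd h (lt_irrefl _)) fun j _ => (hx j).2)
            fun i => Fin.cases (fun h => absurd h (Fin.not_lt_zero _)) fun j hij => ?_
          exact hx' i j (Fin.succ_lt_succ_iff.1 hij)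
        · rintro ⟨v, x⟩ _ ⟨w, y⟩ _ h
          obtain ⟨rfl, rfl⟩ := Fin.cons_inj.1 h
          rfl

/-- Repeating a trial with success probability at least `1 / C` a constant number of times gives
success probability at least `1 / 2`. -/
theorem exists_amplification {C : ℕ} (hC : 0 < C) : ∃ M : ℕ, ∀ (X : Type) [Fintype X]
    [DecidableEq X] (A : Finset X), Fintype.card X ≤ C * A.card →
      Fintype.card X ^ M ≤
        2 * Fintype.card {y : Fin M → X // ∃ i, y i ∈ A} := by
  classical
  have hC' : (0 : ℝ) < C := Nat.cast_pos.2 hC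
  have h1 : (1 : ℝ) ≤ C := Nat.one_le_cast.2 hC
  obtain ⟨M, hM⟩ := exists_pow_lt_of_lt_one (show (0 : ℝ) < 1 / 2 by norm_num)
    (show 1 - 1 / (C : ℝ) < 1 by simpa using hC)
  refine ⟨M, fun X _ _ A hA => ?_⟩
  have hbad : Fintype.card {y : Fin M → X // ¬ ∃ i, y i ∈ A} = (Aᶜ).card ^ M := by
    rw [Fintype.card_subtype]
    have : (Finset.univ.filter fun y : Fin M → X => ¬ ∃ i, y i ∈ A) =
        Fintype.piFinset fun _ => Aᶜ := by
      ext y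
      simp
    rw [this, Fintype.card_piFinset_const]
  have htot : Fintype.card {y : Fin M → X // ∃ i, y i ∈ A} + (Aᶜ).card ^ M =
      Fintype.card X ^ M := by
    rw [← hbad, Fintype.card_subtype_compl, Fintype.card_fun, Fintype.card_fin]
    have := Fintype.card_subtype_le fun y : Fin M → X => ∃ i, y i ∈ A
    rw [Fintype.card_fun, Fintype.card_fin] at this
    omega
  suffices h : 2 * (Aᶜ).card ^ M ≤ Fintype.card X ^ M by omega
  have hle : ((Aᶜ).card : ℝ) ≤ (1 - 1 / (C : ℝ)) * Fintype.card X := by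
    have h2 : (Fintype.card X : ℝ) ≤ C * A.card := by exact_mod_cast hA
    have h3 : (A.card : ℝ) + (Aᶜ).card = Fintype.card X := by
      exact_mod_cast Finset.card_add_card_compl A
    have h4 : (Fintype.card X : ℝ) / C ≤ A.card := by
      rw [div_le_iff₀ hC']
      linarith
    have h5 : (1 - 1 / (C : ℝ)) * Fintype.card X = Fintype.card X - Fintype.card X / C := by ring
    linarith
  have hfin : 2 * ((Aᶜ).card : ℝ) ^ M ≤ (Fintype.card X : ℝ) ^ M := by
    calc 2 * ((Aᶜ).card : ℝ) ^ M ≤ 2 * ((1 - 1 / (C : ℝ)) * Fintype.card X) ^ M := by gcongr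
      _ = 2 * (1 - 1 / (C : ℝ)) ^ M * (Fintype.card X : ℝ) ^ M := by rw [mul_pow, mul_assoc]
      _ ≤ 1 * (Fintype.card X : ℝ) ^ M := by
        gcongr
        linarith
      _ = _ := one_mul _
  exact_mod_cast hfin

/-! ### Verdict probabilities and the random exploration test -/

theorem half_le_uniform_map {X : Type} [Fintype X] [Nonempty X] {n : ℕ} (alg : X → QueryAlg (Fin n))
    (G : SDigraph (Fin n)) (p : X → Prop) [DecidablePred p]
    (hp : ∀ x, p x → (alg x).run G = false)
    (hcard : Fintype.card X ≤ 2 * Fintype.card {x // p x}) :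
    1 / 2 ≤ verdictProb ((PMF.uniformOfFintype X).map alg) G false := by
  classical
  have hsub : {x | p x} ⊆ (QueryAlg.run G ∘ alg) ⁻¹' {false} := fun x hx => hp x hx
  rw [verdictProb, PMF.map_comp, ← PMF.toOuterMeasure_apply_singleton,
    PMF.toOuterMeasure_map_apply]
  refine le_trans ?_ (MeasureTheory.measure_mono hsub)
  rw [PMF.toOuterMeasure_uniformOfFintype_apply]
  have h0 : (Fintype.card X : ENNReal) ≠ 0 := Nat.cast_ne_zero.2 Fintype.card_ne_zero
  rw [ENNReal.le_div_iff_mul_le (Or.inl h0) (Or.inl (ENNReal.natCast_ne_top _)),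
    mul_comm, mul_one_div]
  refine ENNReal.div_le_of_le_mul ?_
  rw [mul_comm]
  exact_mod_cast hcard

theorem verdictProb_map_eq_one {X : Type} {n : ℕ} (μ : PMF X) (alg : X → QueryAlg (Fin n))
    (G : SDigraph (Fin n)) (h : ∀ x, (alg x).run G = true) :
    verdictProb (μ.map alg) G true = 1 := by
  rw [verdictProb, PMF.map_comp, PMF.apply_eq_one_iff]
  have : QueryAlg.run G ∘ alg = Function.const X true := funext h
  rw [this, PMF.map_const, PMF.support_pure]

/-- The pairs of a digraph with at most `r` vertices and one of its vertices. -/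
abbrev RootedPattern (r : ℕ) : Type := Σ m : Fin (r + 1), SDigraph (Fin m) × Fin m

/-- A bounded degree digraph that is far from being `H`-free contains a member of `H` all of whose
components have many copies. -/
theorem exists_frequent {d n r L : ℕ} {ε : ℝ} {H : Set FinDigraph} (hH : IsRSet r H)
    (hL : 0 < L) (hLε : 4 * (Nat.card (RootedPattern r) : ℝ) ≤ ε * L) {G : SDigraph (Fin n)}
    (hG : G.FB d) (hfar : ¬ CloseTo d (ε / 2) G (slice (inducedFree d H) n)) :
    ∃ K ∈ H, ∀ i : Fin K.1, n / L ≤ (G.rootCopies K.2 i).card := by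
  classical
  have := Fintype.ofFinite (RootedPattern r)
  let rare : Finset (RootedPattern r) :=
    Finset.univ.filter fun p => (G.rootCopies p.2.1 p.2.2).card < n / L
  let R : Finset (Fin n) := rare.biUnion fun p => G.rootCopies p.2.1 p.2.2
  have hR : R.card ≤ Nat.card (RootedPattern r) * (n / L) := by
    refine (Finset.card_biUnion_le_card_mul _ _ (n / L) fun p hp =>
      (Finset.mem_filter.1 hp).2.le).trans (Nat.mul_le_mul_right _ ?_)
    rw [Nat.card_eq_fintype_card]
    exact Finset.card_le_univ _
  have hclose : Close d (ε / 2) G (G.isolate R) := by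
    have hL' : (0 : ℝ) < L := Nat.cast_pos.2 hL
    have h1 : (G.editDist (G.isolate R) : ℝ) ≤ R.card * (2 * d) := by
      exact_mod_cast editDist_isolate_le hG R
    have h2 : (R.card : ℝ) ≤ Nat.card (RootedPattern r) * (n / L : ℝ) := by
      refine (show (R.card : ℝ) ≤ Nat.card (RootedPattern r) * ((n / L : ℕ) : ℝ) by
        exact_mod_cast hR).trans ?_
      gcongr
      exact Nat.cast_div_le
    -- With at most 2d edges lost per vertex of `R`, the quarter here becomes the half in `Close d
    -- (ε / 2)`.
    have h3 : (Nat.card (RootedPattern r) : ℝ) * (n / L : ℝ) ≤ ε / 4 * n := by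
      rw [← mul_div_assoc, div_le_iff₀ hL']
      nlinarith [(Nat.cast_nonneg n : (0 : ℝ) ≤ n)]
    calc (G.editDist (G.isolate R) : ℝ) ≤ R.card * (2 * d) := h1
      _ ≤ ε / 4 * n * (2 * d) := by
        gcongr
        exact h2.trans h3
      _ = ε / 2 * d * n := by ring
  obtain ⟨K, hK, hind⟩ : ∃ K ∈ H, (G.isolate R).HasInduced K.2 := by
    by_contra! hc
    exact hfar ⟨_, ⟨hG.isolate R, hc⟩, hclose⟩
  refine ⟨K, hK, fun i => ?_⟩
  -- An isolated vertex of `K` may be embedded into `R`, but its one-vertex component has a copy at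
  -- every vertex of `G`.
  by_cases hi : ∃ j, K.2.und.Adj i j
  · obtain ⟨j, hj⟩ := hi
    obtain ⟨v, hv, hvR⟩ := exists_rootCopy_notMem hind hj
    by_contra! hlt
    refine hvR (Finset.mem_biUnion.2
      ⟨⟨⟨K.1, Nat.lt_succ_of_le (hH K hK)⟩, K.2, i⟩, ?_, hv⟩)
    exact Finset.mem_filter.2 ⟨Finset.mem_univ _, hlt⟩
  · rw [rootCopies_eq_univ_of_isolated G (not_exists.1 hi), Finset.card_univ, Fintype.card_fin]
    exact Nat.div_le_self n L

/-- If all components of `K` have many copies in `G`, then a positive proportion of the tuples of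
vertices of `G` have neighbourhoods that certify that `K` is an induced subgraph. -/
theorem exists_witness_tuples {d n r L : ℕ} (hL : 0 < L) {G : SDigraph (Fin n)} (hG : G.FB d)
    (hn : 2 * L + 2 * L * (r * (2 * d + 1) ^ (2 * r + 1)) ≤ n) {K : FinDigraph} (hK : K.1 ≤ r)
    (hfreq : ∀ i : Fin K.1, n / L ≤ (G.rootCopies K.2 i).card) :
    ∃ A : Finset (Fin r → Fin n), n ^ r ≤ (2 * L) ^ r * A.card ∧
      ∀ x ∈ A, ∀ G' : SDigraph (Fin n),
        (∀ i u, G.Within r (x i) u → G.Agree G' u) → G'.HasInduced K.2 := by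
  classical
  set B := (2 * d + 1) ^ (2 * r + 1) with hB
  let W : Fin r → Finset (Fin n) := fun i =>
    if h : i.1 < K.1 then G.rootCopies K.2 ⟨i, h⟩ else Finset.univ
  have hWn : ∀ i, n / L ≤ (W i).card := fun i => by
    by_cases h : i.1 < K.1
    · simp only [W, dif_pos h]
      exact hfreq _
    · simpa [W, dif_neg h] using Nat.div_le_self n L
  have h1 : n < L * (n / L) + L := by
    have := Nat.lt_mul_div_succ n hL
    rwa [Nat.mul_add, mul_one] at this
  -- The lower bound on `n` absorbs both the rounding in `n / L` and the loss `r * B`, at the price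
  -- of a factor 2.
  have h2 : n ≤ 2 * L * (n / L - r * B) := by
    rw [Nat.mul_sub]
    have h3 : 2 * L * (n / L) = 2 * (L * (n / L)) := Nat.mul_assoc _ _ _
    omega
  have h4 : r * B ≤ n / L := by
    rw [Nat.le_div_iff_mul_le hL]
    nlinarith
  have hcount := pow_le_card_unrelated (G.Within (2 * r + 1)) (n / L - r * B) B
    (fun v => card_within_le hG _ v) r W fun i => by
      rw [Nat.sub_add_cancel h4]
      exact hWn i
  refine ⟨Finset.univ.filter fun x : Fin r → Fin n =>
    (∀ i, x i ∈ W i) ∧ ∀ i j, i < j → ¬ G.Within (2 * r + 1) (x i) (x j),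
    ?_, fun x hx G' hag => ?_⟩
  · calc n ^ r ≤ (2 * L * (n / L - r * B)) ^ r := Nat.pow_le_pow_left h2 r
      _ = (2 * L) ^ r * (n / L - r * B) ^ r := Nat.mul_pow _ _ _
      _ ≤ _ := by
        refine Nat.mul_le_mul_left _ (hcount.trans (le_of_eq ?_))
        congr
  · obtain ⟨hxW, hxR⟩ := (Finset.mem_filter.1 hx).2
    refine hasInduced_of_rootCopies hK (x := fun i => x (Fin.castLE hK i)) (fun i => ?_)
      (fun i j hij => ?_) fun i u => hag _ u
    · simpa [W] using hxW (Fin.castLE hK i)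
    · rcases lt_or_gt_of_ne hij with h | h
      · exact hxR _ _ h
      · exact fun hw => hxR _ _ h hw.symm

/-- Exploring from a random set of vertices is a one-sided error test if, on inputs that are far
from the property, the explored part excludes membership for half of the choices. -/
theorem isOneSidedTest_explore {d n ρ s : ℕ} {ε : ℝ} {P : Set FinDigraph} {X : Type} [Fintype X]
    [Nonempty X] (S : X → Finset (Fin n)) (hS : ∀ x, (S x).card ≤ s)
    (hrej : ∀ G : SDigraph (Fin n), G.FB d → ¬ CloseTo d ε G (slice P n) → ∃ p : X → Prop,
      Nat.card X ≤ 2 * Nat.card {x // p x} ∧ ∀ x, p x → ∀ G' ∈ slice P n,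
        ¬ ∀ v ∈ QueryAlg.explored G ρ (S x), G.Agree G' v) :
    ∃ T : RandAlg n, IsOneSidedTest d P ε n T ∧
      QueriesAtMost d T (QueryAlg.exploreCost d ρ s) := by
  classical
  refine ⟨(PMF.uniformOfFintype X).map fun x => QueryAlg.explore ρ (S x) (slice P n),
    ⟨fun G hG => ?_, fun G hG hfar => ?_⟩, fun G hG t ht => ?_⟩
  · exact verdictProb_map_eq_one _ _ _ fun x =>
      (QueryAlg.run_explore G ρ (S x) _).2 ⟨G, hG, fun v _ => Agree.refl G v⟩
  · obtain ⟨p, hp, hpr⟩ := hrej G hG hfar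
    refine half_le_uniform_map _ G p (fun x hx => ?_) (by simpa using hp)
    rw [Bool.eq_false_iff]
    intro h
    obtain ⟨G', hG', hag⟩ := (QueryAlg.run_explore G ρ (S x) _).1 h
    exact hpr x hx G' hG' hag
  · obtain ⟨x, -, rfl⟩ := (PMF.mem_support_map_iff _ _ _).1 ht
    exact (QueryAlg.numQueries_explore_le hG _ _ _).trans (QueryAlg.exploreCost_mono _ _ (hS x))

theorem testable_of_forbidden {d : ℕ} {P : Set FinDigraph}
    (h : ∀ ε : ℝ, 0 < ε → ∃ (r nstar : ℕ) (H : Set FinDigraph), IsRSet r H ∧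
      ∀ n : ℕ, nstar < n → slice P n ⊆ slice (inducedFree d H) n ∧
        SetsClose d (ε / 2) (slice (inducedFree d H) n) (slice P n)) :
    OneSidedStronglyTestable d P := by
  classical
  suffices hQ : ∀ ε : Set.Ioo (0 : ℝ) 1, ∃ q : ℕ, ∀ n : ℕ,
      ∃ T : RandAlg n, IsOneSidedTest d P ε n T ∧ QueriesAtMost d T q by
    choose Q hQ using hQ
    exact ⟨Q, hQ⟩
  rintro ⟨ε, hε, -⟩
  obtain ⟨r, nstar, H, hH, hn⟩ := h ε hε
  obtain ⟨L₀, hL₀⟩ := exists_nat_ge (4 * (Nat.card (RootedPattern r) : ℝ) / ε)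
  let L := L₀ + 1
  have hL : 0 < L := Nat.succ_pos _
  have hLε : 4 * (Nat.card (RootedPattern r) : ℝ) ≤ ε * L := by
    rw [div_le_iff₀ hε] at hL₀
    push_cast [L]
    nlinarith
  obtain ⟨M, hM⟩ := exists_amplification (C := (2 * L) ^ r) (by positivity)
  let N₀ := max nstar (2 * L + 2 * L * (r * (2 * d + 1) ^ (2 * r + 1)))
  refine ⟨max (QueryAlg.exploreCost d 1 N₀) (QueryAlg.exploreCost d (r + 1) (M * r)),
    fun n => ?_⟩
  suffices hT : ∃ ρ s, QueryAlg.exploreCost d ρ s ≤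
      max (QueryAlg.exploreCost d 1 N₀) (QueryAlg.exploreCost d (r + 1) (M * r)) ∧
      ∃ T : RandAlg n, IsOneSidedTest d P ε n T ∧
        QueriesAtMost d T (QueryAlg.exploreCost d ρ s) by
    obtain ⟨ρ, s, hle, T, hT, hq⟩ := hT
    exact ⟨T, hT, fun G hG t ht => (hq G hG t ht).trans hle⟩
  by_cases hnN : n ≤ N₀
  -- For small `n`, one round from all vertices determines `G` completely.
  · refine ⟨1, N₀, le_max_left _ _, isOneSidedTest_explore (X := Unit)
      (fun _ => Finset.univ) (fun _ => by simpa using hnN) fun G hG hfar =>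
        ⟨fun _ => True, by simp, fun _ _ G' hG' hag => hfar ⟨G, ?_, Close.refl hε.le G⟩⟩⟩
    have : G' = G := by
      ext u v
      exact (hag u (mem_explored zero_lt_one (Finset.mem_univ u)
        (Within.refl G 0 u))).adj_iff v
    exact this ▸ hG'
  · have hn' := max_lt_iff.1 (not_le.1 hnN)
    have : Nonempty (Fin n) := ⟨⟨0, by omega⟩⟩
    -- `M` independent `r`-tuples of roots; `r + 1` rounds reach distance `r` from each.
    refine ⟨r + 1, M * r, le_max_right _ _, isOneSidedTest_explore
      (X := Fin M → Fin r → Fin n)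
      (fun y => Finset.univ.image fun p : Fin M × Fin r => y p.1 p.2)
      (fun y => Finset.card_image_le.trans (by simp)) fun G hG hfar => ?_⟩
    have hfar' : ¬ CloseTo d (ε / 2) G (slice (inducedFree d H) n) := by
      rintro ⟨G₁, hG₁, h₁⟩
      obtain ⟨G₂, hG₂, h₂⟩ := (hn n hn'.1).2.1 G₁ hG₁
      refine hfar ⟨G₂, hG₂, ?_⟩
      have h₃ : (G.editDist G₂ : ℝ) ≤ G.editDist G₁ + G₁.editDist G₂ := by
        exact_mod_cast editDist_triangle G G₁ G₂
      rw [Close] at *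
      linarith
    obtain ⟨K, hK, hfreq⟩ := exists_frequent hH hL hLε hG hfar'
    obtain ⟨A, hA, hAK⟩ := exists_witness_tuples hL hG hn'.2.le (hH K hK) hfreq
    refine ⟨fun y => ∃ i, y i ∈ A, ?_, ?_⟩
    · simpa using hM (Fin r → Fin n) A (by simpa using hA)
    · rintro y ⟨i, hi⟩ G' hG' hag
      -- By (a), a consistent member of `P_n` would have to be `H`-free, yet the explored part
      -- forces `K` into it.
      refine ((hn n hn'.1).1 hG').2 K hK (hAK _ hi G' fun j u hju => hag u ?_)
      exact mem_explored (Nat.lt_succ_self r)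
        (Finset.mem_image_of_mem _ (Finset.mem_univ (i, j))) hju

end BoundedDegree

theorem theorem6p4 (d : ℕ) (P : Set BoundedDegree.FinDigraph)
    (hP : BoundedDegree.IsProperty d P) (hher : BoundedDegree.IsHereditary P) :
    BoundedDegree.OneSidedStronglyTestable d P ↔
      ∀ ε : ℝ, 0 < ε → ∃ (r nstar : ℕ) (H : Set BoundedDegree.FinDigraph),
        BoundedDegree.IsRSet r H ∧
        ∀ n : ℕ, nstar < n →
          BoundedDegree.slice P n ⊆ BoundedDegree.slice (BoundedDegree.inducedFree d H) n ∧
          BoundedDegree.SetsClose d (ε / 2)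
            (BoundedDegree.slice (BoundedDegree.inducedFree d H) n)
            (BoundedDegree.slice P n) :=
  ⟨fun h _ hε => BoundedDegree.exists_forbidden_of_testable hP hher h hε,
    BoundedDegree.testable_of_forbidden⟩
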